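/- Let $\Delta^M$ be the abstract simplex with vertex set $\{0,\dots,M\}$, and let $(C_*(\Delta^M),\partial)$ be its simplicial chain complex with integral coefficients. The support $\mathrm{supp}(Z)$ of a chain $Z\in C_{k}(\Delta^M)$ is the simplicial complex consisting of all $k$-simplices that enter $Z$ with non-zero coefficient, and all their faces. Let $Z=\sum_{i=1}^q c_i\{v^{(i)}_1,\dots,v^{(i)}_n\}$, $c_i\in\mathbb{Z}$, be an $(n-1)$-cycle of $\Delta^M$, written as a combination of oriented simplices. A complex simplicial polyhedron $(Z,P)$ in $\mathbb{C}^n$ of combinatorial type $Z$ is given by a mapping $P\colon|\mathrm{supp}(Z)|\to\mathbb{C}^n$ whose restriction to every simplex of $|\mathrm{supp}(Z)|$ is (affine) linear. Write $x_{v,1}(P),\dots,x_{v,n}(P)$ for the coordinates of the image $P(v)$ of a vertex $v$. The squares of the orthogonal (not Hermitian) edge lengths and the generalized oriented volume of $(Z,P)$ are the complex numbers $$\ell_{uv}(P)=\sum_{j=1}^n\bigl(x_{u,j}(P)-x_{v,j}(P)\bigr)^2,\qquad V_Z(P)=\frac1{n!}\sum_{i=1}^q c_i\det\bigl(x_{v^{(i)}_k,j}(P)\bigr)_{j,k=1}^n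 .$$ 1. For every $n\ge 3$, every $M$ and every $(n-1)$-cycle $Z$ of $\Delta^M$, there is a constant $C_Z$, depending only on $Z$, such that every complex simplicial polyhedron $(Z,P)$ in $\mathbb{C}^n$ of combinatorial type $Z$ satisfies $$|V_Z(P)|\le C_Z\Bigl(\max_{\{u,v\}}|\ell_{uv}(P)|\Bigr)^{n/2},$$ where the maximum is over all edges $\{u,v\}$ of $\mathrm{supp}(Z)$ (and is read as $0$ if $Z=0$). 2. The bound fails for $n=2$: there are an $M$ and a $1$-cycle $Z$ of $\Delta^M$ such that no constant $C$ satisfies $|V_Z(P)|\le C\max_{\{u,v\}}|\ell_{uv}(P)|$ for all complex simplicial polyhedra $(Z,P)$ in $\mathbb{C}^2$ of combinatorial type $Z$. -/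

import Mathlib

open scoped NNReal

namespace ComplexPolyhedra

noncomputable section

/-- The `(k-1)`-dimensional faces of the abstract simplex `Δ^M` with vertex set `{0, …, M}`:
the sets of exactly `k` vertices. -/
abbrev Face (M k : ℕ) : Type := {σ : Finset (Fin (M + 1)) // σ.card = k}

/-- The chain group `C_{k-1}(Δ^M)` with integral coefficients: the free abelian group on the
`(k-1)`-dimensional faces. The basis element of a face `{v_1 < ⋯ < v_k}` is this face with the
orientation given by the increasing order of its vertices; the oppositely oriented face is minus
that basis element. -/
abbrev FaceChain (M k : ℕ) : Type := Face M k →₀ ℤ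

/-- The facet of `σ` opposite to its vertex `v`. -/
def Face.erase {M k : ℕ} (σ : Face M k) (v : {v // v ∈ σ.1}) : Face M (k - 1) :=
  ⟨σ.1.erase v.1, by rw [Finset.card_erase_of_mem v.2, σ.2]⟩

/-- The simplicial boundary operator `C_{k-1}(Δ^M) → C_{k-2}(Δ^M)`,
`∂{v_0, …, v_{k-1}} = ∑ i, (-1)^i {v_0, …, v̂_i, …, v_{k-1}}` for `v_0 < ⋯ < v_{k-1}`;
the position `i` of a vertex `v` is the number of vertices of the face that precede it. -/
def boundary (M k : ℕ) : FaceChain M k →ₗ[ℤ] FaceChain M (k - 1) :=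
  Finsupp.linearCombination ℤ fun σ : Face M k =>
    ∑ v : {v // v ∈ σ.1},
      Finsupp.single (σ.erase v) ((-1 : ℤ) ^ (σ.1.filter fun w => w < v.1).card)

/-- A chain is a cycle if its boundary vanishes. -/
def IsCycle {M k : ℕ} (Z : FaceChain M k) : Prop := boundary M k Z = 0

/-- The support of a chain: the simplicial complex of all (nonempty) faces of the simplices that
enter the chain with non-zero coefficients. -/
def supp {M k : ℕ} (Z : FaceChain M k) : PreAbstractSimplicialComplex (Fin (M + 1)) where
  faces := {τ | τ.Nonempty ∧ ∃ σ : Face M k, Z σ ≠ 0 ∧ τ ⊆ σ.1}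
  isRelLowerSet_faces := by
    rintro τ ⟨hτ, σ, hσ, hτσ⟩
    exact ⟨hτ, fun ρ hρ hne => ⟨hne, σ, hσ, hρ.trans hτσ⟩⟩

/-- The geometric realization `|K|`, in barycentric coordinates. -/
def realization {M : ℕ} (K : PreAbstractSimplicialComplex (Fin (M + 1))) :
    Set (Fin (M + 1) → ℝ) :=
  {x | x ∈ stdSimplex ℝ (Fin (M + 1)) ∧ ∃ σ ∈ K, ∀ v ∉ σ, x v = 0}

/-- The point of `|K|` given by a vertex of `K`. -/
def vertexPoint {M : ℕ} (K : PreAbstractSimplicialComplex (Fin (M + 1))) (v : Fin (M + 1))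
    (hv : {v} ∈ K) : realization K :=
  ⟨Pi.single v 1, single_mem_stdSimplex ℝ v, {v}, hv, fun w hw => by
    rw [Finset.mem_singleton] at hw
    simp [hw]⟩

/-- A complex simplicial polyhedron in `ℂ^n` of combinatorial type `Z`: a mapping
`|supp Z| → ℂ^n` whose restriction to every simplex of `|supp Z|` is (affine) linear. -/
structure Polyhedron {M n : ℕ} (Z : FaceChain M n) where
  toFun : realization (supp Z) → (Fin n → ℂ)
  linear_on_simplices : ∀ σ ∈ supp Z, ∃ A : (Fin (M + 1) → ℝ) →ᵃ[ℝ] (Fin n → ℂ),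
    ∀ x : realization (supp Z), (∀ v ∉ σ, x.1 v = 0) → toFun x = A x.1

namespace Polyhedron

variable {M n : ℕ} {Z : FaceChain M n}

open Classical in
/-- The image `P(v)` of a vertex `v` of `supp Z` (only such `v` are ever used). -/
def vertex (P : Polyhedron Z) (v : Fin (M + 1)) : Fin n → ℂ :=
  if hv : {v} ∈ supp Z then P.toFun (vertexPoint (supp Z) v hv) else 0

/-- The square of the orthogonal (not Hermitian) distance between `P(u)` and `P(v)`. -/
def sqLength (P : Polyhedron Z) (u v : Fin (M + 1)) : ℂ :=
  ∑ i : Fin n, (P.vertex u i - P.vertex v i) ^ 2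

open Classical in
/-- The maximum of `|ℓ_{uv}(P)|` over all edges `{u, v}` of `supp Z`
(zero if there are no edges, that is, for `Z = 0` in dimension `n ≥ 2`). -/
def maxSqLength (P : Polyhedron Z) : ℝ≥0 :=
  (Finset.univ.filter fun e : Fin (M + 1) × Fin (M + 1) =>
      e.1 ≠ e.2 ∧ ({e.1, e.2} : Finset (Fin (M + 1))) ∈ supp Z).sup
    fun e => ‖P.sqLength e.1 e.2‖₊

/-- The generalized oriented volume
`V_Z(P) = (1 / n!) ∑ σ, c_σ det (P(v_1), …, P(v_n))` for `Z = ∑ σ, c_σ σ`, where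
`σ = {v_1 < ⋯ < v_n}` and the `P(v_j)` are the columns of the determinant. -/
def volume (P : Polyhedron Z) : ℂ :=
  (1 / (n.factorial : ℂ)) * ∑ σ ∈ Z.support,
    (Z σ : ℂ) * (Matrix.of fun i j : Fin n => P.vertex (σ.1.orderEmbOfFin σ.2 j) i).det

end Polyhedron

end

end ComplexPolyhedra

/-!
For the bound, it suffices to treat polyhedra whose squared edge lengths are at most `1`, because
both sides are homogeneous. If the volume were unbounded on these, a sequence of them would give a
configuration of points over an ultrapower `F` of `ℂ` with squared edge lengths in the valuation
ring `O` of bounded elements, but with volume outside `O`. So the claim is that, over a field `F`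
with a valuation ring `O` containing `1/2` and with a square root `i` of `-1`, the volume of a cycle
whose edges have integral squared lengths is integral (`chainVolume_mem`).

Consider the complex of all cliques of vertices with mutually integral distances. The squared
volume of an `n`-simplex of this complex is, up to a constant, the Gram determinant of its edge
vectors, hence integral by polarization (`edge_det_mem`). So it is enough that the `(n-1)`-cycle
bounds in this complex (`exists_bd_eq_of_isClique`).

To see this, take `d = ⌊n/2⌋` isotropic coordinates `y_j = x_{2j} + i x_{2j+1}`. On the common
kernel of the `y_j` the quadratic form is the square of a single linear form
(`exists_linearMap_isotropic`). Grade the cliques by the affine `O`-lattice in `F^d` that their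
`y`-coordinates span. Two points integrally distant from a clique, with `y`-coordinates in its
lattice, are integrally distant from each other (`integralDist_twin`). Hence the cliques with a given
lattice `Λ` are, class by class, the generating subsets of one largest clique. By Nakayama's lemma
a set is generating if and only if it spans the reduction of `Λ`, whose dimension (after passing
from affine to linear spans) is at most `d + 1`. The simplex modulo its non-spanning subsets has no
homology in sets of more than `d + 1` elements (`exists_sub_bd_nonspanning`), so that a cycle can
be pushed to smaller and smaller lattices as long as `n > d + 1`, that is, for `n ≥ 3`.

For `n = 2` the parallelogram spanned by two isotropic vectors has sides of length zero and nonzero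
area.
-/

namespace ComplexPolyhedra

/-! ### Chains on a finite ordered set of vertices -/

section Chains

variable {V : Type*} [LinearOrder V]

/-- The sign `(-1) ^ i`, where `i` is the number of elements of `σ` that precede `v`. -/
def orderSign (v : V) (σ : Finset V) : ℤ := (-1) ^ (σ.filter (· < v)).card

lemma orderSign_mul_self (v : V) (σ : Finset V) : orderSign v σ * orderSign v σ = 1 := by
  rw [orderSign, ← mul_pow]; simp

lemma orderSign_insert {v w : V} {σ : Finset V} (hw : w ∉ σ) :
    orderSign v (insert w σ) = if w < v then -orderSign v σ else orderSign v σ := by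
  unfold orderSign
  rw [Finset.filter_insert]
  split_ifs with h
  · rw [Finset.card_insert_of_notMem (by simp [hw]), pow_succ]; ring
  · rfl

lemma orderSign_insert_self (v : V) (σ : Finset V) : orderSign v (insert v σ) = orderSign v σ := by
  unfold orderSign
  rw [Finset.filter_insert, if_neg (lt_irrefl v)]

lemma orderSign_erase_self (v : V) (σ : Finset V) : orderSign v (σ.erase v) = orderSign v σ := by
  by_cases hv : v ∈ σ
  · rw [← orderSign_insert_self, Finset.insert_erase hv]
  · rw [Finset.erase_eq_of_notMem hv]

/-- The coefficient of `v` in a chain: the chain `y` without `v` such that `c = v * y + w` with `w`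
free of `v`. An integral chain is encoded as its coefficient function on all finite sets of vertices
(the empty one included), each set being oriented by the order of its vertices. In these terms
`link v` and `cone v` are the annihilation and creation operators of the exterior algebra. -/
def link (v : V) : (Finset V → ℤ) →ₗ[ℤ] (Finset V → ℤ) where
  toFun c σ := if v ∈ σ then 0 else orderSign v σ * c (insert v σ)
  map_add' c d := by ext σ; by_cases h : v ∈ σ <;> simp [h, mul_add]
  map_smul' a c := by ext σ; by_cases h : v ∈ σ <;> simp [h, mul_left_comm]

/-- The chain `v * c`; the simplices of `c` that contain `v` contribute zero. -/
def cone (v : V) : (Finset V → ℤ) →ₗ[ℤ] (Finset V → ℤ) where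
  toFun c σ := if v ∈ σ then orderSign v σ * c (σ.erase v) else 0
  map_add' c d := by ext σ; by_cases h : v ∈ σ <;> simp [h, mul_add]
  map_smul' a c := by ext σ; by_cases h : v ∈ σ <;> simp [h, mul_left_comm]

lemma link_apply (v : V) (c : Finset V → ℤ) (σ : Finset V) :
    link v c σ = if v ∈ σ then 0 else orderSign v σ * c (insert v σ) := rfl

lemma cone_apply (v : V) (c : Finset V → ℤ) (σ : Finset V) :
    cone v c σ = if v ∈ σ then orderSign v σ * c (σ.erase v) else 0 := rfl

lemma link_link_self (v : V) (c : Finset V → ℤ) : link v (link v c) = 0 := by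
  ext σ; simp [link_apply]

lemma link_link (v w : V) (c : Finset V → ℤ) : link v (link w c) = -link w (link v c) := by
  rcases eq_or_ne v w with rfl | hvw
  · simp [link_link_self]
  ext σ
  by_cases hv : v ∈ σ <;> by_cases hw : w ∈ σ <;>
    simp [link_apply, hv, hw, hvw, hvw.symm]
  rw [orderSign_insert hv, orderSign_insert hw, Finset.insert_comm]
  rcases hvw.lt_or_gt with h | h <;> simp [h, h.not_gt] <;> ring

lemma link_cone_self (v : V) (c : Finset V → ℤ) : link v (cone v c) + cone v (link v c) = c := by
  ext σ
  by_cases hv : v ∈ σ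
  · simp [link_apply, cone_apply, hv, orderSign_erase_self, ← mul_assoc, orderSign_mul_self]
  · simp [link_apply, cone_apply, hv, orderSign_insert_self, ← mul_assoc, orderSign_mul_self]

lemma link_cone_of_ne {v w : V} (hvw : v ≠ w) (c : Finset V → ℤ) :
    link w (cone v c) + cone v (link w c) = 0 := by
  ext σ
  by_cases hv : v ∈ σ <;> by_cases hw : w ∈ σ <;>
    simp [link_apply, cone_apply, hv, hw, hvw, hvw.symm]
  obtain ⟨τ, hτ, rfl⟩ : ∃ τ, v ∉ τ ∧ σ = insert v τ :=
    ⟨σ.erase v, by simp, (Finset.insert_erase hv).symm⟩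
  have hw' : w ∉ τ := fun h => hw (Finset.mem_insert_of_mem h)
  rw [Finset.insert_comm, Finset.erase_insert (by simp [hτ, hvw]), Finset.erase_insert hτ,
    orderSign_insert_self, orderSign_insert_self, orderSign_insert hw', orderSign_insert hτ]
  rcases hvw.lt_or_gt with h | h <;> simp [h, h.not_gt] <;> ring

variable [Fintype V]

/-- The augmented simplicial boundary, as the sum of the contractions `link v`. -/
def bd : (Finset V → ℤ) →ₗ[ℤ] (Finset V → ℤ) := ∑ v, link v

lemma bd_eq_sum (c : Finset V → ℤ) : bd c = ∑ v, link v c := by simp [bd]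

lemma bd_apply (c : Finset V → ℤ) (σ : Finset V) :
    bd c σ = ∑ v, if v ∈ σ then 0 else orderSign v σ * c (insert v σ) := by
  simp [bd_eq_sum, link_apply]

lemma bd_link (v : V) (c : Finset V → ℤ) : bd (link v c) = -link v (bd c) := by
  simp only [bd_eq_sum, map_sum, ← Finset.sum_neg_distrib]
  exact Finset.sum_congr rfl fun w _ => link_link w v c

lemma bd_bd (c : Finset V → ℤ) : bd (bd c) = 0 := by
  have h : bd (bd c) = -bd (bd c) := by
    conv_lhs => rw [bd_eq_sum c, map_sum]
    simp only [bd_link, Finset.sum_neg_distrib]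
    rw [← bd_eq_sum]
  exact self_eq_neg.mp h

lemma bd_cone (v : V) (c : Finset V → ℤ) : bd (cone v c) + cone v (bd c) = c := by
  rw [bd_eq_sum, bd_eq_sum, map_sum, ← Finset.sum_add_distrib,
    Finset.sum_eq_single_of_mem v (Finset.mem_univ v), link_cone_self]
  exact fun w _ hw => link_cone_of_ne hw.symm c

lemma exists_insert_of_bd_ne_zero {c : Finset V → ℤ} {ρ : Finset V} (h : bd c ρ ≠ 0) :
    ∃ v ∉ ρ, c (insert v ρ) ≠ 0 := by
  rw [bd_apply] at h
  obtain ⟨v, -, hv⟩ := Finset.exists_ne_zero_of_sum_ne_zero h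
  by_cases hvρ : v ∈ ρ
  · simp [hvρ] at hv
  · rw [if_neg hvρ] at hv
    exact ⟨v, hvρ, right_ne_zero_of_mul hv⟩

end Chains

/-! ### Relative cycles modulo non-spanning sets -/

section Spanning

variable {V : Type*} [LinearOrder V] [Fintype V]

/-- Let vectors `f v` of a vector space `W` be attached to the vertices, and fix a subspace `S`. The
sets `σ` for which `S` and `f '' σ` do not span `W` form a simplicial complex. Modulo this complex,
a relative cycle made of sets with more than `dim (W / S)` elements is a relative boundary. (This is
the homology of the complex of non-spanning sets of a matroid; the proof is by deletion and
contraction, contraction by `v` being the passage from `S` to `S ⊔ span {f v}`.) -/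
lemma exists_sub_bd_nonspanning {k W : Type*} [Field k] [AddCommGroup W] [Module k W]
    [FiniteDimensional k W] (f : V → W) (G : Finset V) (S : Submodule k W) (s : ℕ)
    (hs : Module.finrank k W < Module.finrank k S + s) (c : Finset V → ℤ)
    (hc : ∀ σ, c σ ≠ 0 → σ ⊆ G ∧ σ.card = s)
    (hbd : ∀ σ, bd c σ ≠ 0 → S ⊔ Submodule.span k (f '' σ) ≠ ⊤) :
    ∃ d : Finset V → ℤ, (∀ σ, d σ ≠ 0 → σ ⊆ G ∧ σ.card = s + 1) ∧
      ∀ σ, (c - bd d) σ ≠ 0 → S ⊔ Submodule.span k (f '' σ) ≠ ⊤ := by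
  induction G using Finset.induction_on generalizing S s c with
  | empty =>
    refine ⟨0, by simp, fun σ hσ => ?_⟩
    have h := hc σ (by simpa using hσ)
    have : s = 0 := by rw [← h.2, Finset.subset_empty.mp h.1, Finset.card_empty]
    have := S.finrank_le
    omega
  | insert v G hv ih =>
    -- Membership of `v` in `σ` contributes `f v` to the span.
    have hspan : ∀ σ : Finset V, v ∈ σ → S ⊔ Submodule.span k (f '' σ) =
        (S ⊔ Submodule.span k {f v}) ⊔ Submodule.span k (f '' (σ.erase v : Finset V)) := by
      intro σ hσ
      conv_lhs => rw [← Finset.insert_erase hσ]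
      rw [Finset.coe_insert, Set.image_insert_eq, Submodule.span_insert, sup_assoc]
    have hdown : ∀ d : Finset V → ℤ,
        (∀ σ, d σ ≠ 0 → S ⊔ Submodule.span k (f '' σ) ≠ ⊤) →
        ∀ σ, bd d σ ≠ 0 → S ⊔ Submodule.span k (f '' σ) ≠ ⊤ := by
      intro d hd σ hσ htop
      obtain ⟨w, -, hw⟩ := exists_insert_of_bd_ne_zero hσ
      refine hd _ hw (top_le_iff.mp (htop.ge.trans (sup_le_sup_left (Submodule.span_mono
        (Set.image_mono ?_)) _)))
      exact_mod_cast Finset.subset_insert w σ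
    set y := link v c with hy
    set w := link v (cone v c) with hw
    have hcw : c = cone v y + w := by rw [hy, hw, add_comm, link_cone_self]
    have hw0 : ∀ σ, w σ ≠ 0 → v ∉ σ ∧ c σ ≠ 0 := by
      intro σ hσ
      have hvσ : v ∉ σ := fun h => hσ (by simp [hw, link_apply, h])
      refine ⟨hvσ, fun h => hσ ?_⟩
      rw [hcw] at h
      simpa [cone_apply, hvσ] using h
    have hwG : ∀ σ, w σ ≠ 0 → σ ⊆ G ∧ σ.card = s := by
      intro σ hσ
      obtain ⟨hvσ, h⟩ := hw0 σ hσ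
      exact ⟨(Finset.subset_insert_iff_of_notMem hvσ).mp (hc σ h).1, (hc σ h).2⟩
    have hyG : ∀ σ, y σ ≠ 0 → σ ⊆ G ∧ σ.card + 1 = s := by
      intro σ hσ
      have hvσ : v ∉ σ := fun h => hσ (by simp [hy, link_apply, h])
      have h : c (insert v σ) ≠ 0 := fun h => hσ (by simp [hy, link_apply, h])
      obtain ⟨h1, h2⟩ := hc _ h
      rw [Finset.card_insert_of_notMem hvσ] at h2
      refine ⟨?_, h2⟩
      exact (Finset.subset_insert_iff_of_notMem hvσ).mp ((Finset.subset_insert v σ).trans h1)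
    -- If `v` is a loop, coning with `v` preserves non-spanning sets and kills the relative cycle.
    by_cases hfv : f v ∈ S
    · have hsup : S ⊔ Submodule.span k {f v} = S := by
        rwa [sup_eq_left, Submodule.span_singleton_le_iff_mem]
      refine ⟨cone v w, fun σ hσ => ?_, fun σ hσ => ?_⟩
      · have hvσ : v ∈ σ := by
          by_contra h
          simp [cone_apply, h] at hσ
        obtain ⟨h1, h2⟩ := hwG (σ.erase v) fun h => hσ (by simp [cone_apply, h])
        rw [Finset.card_erase_of_mem hvσ] at h2
        have := Finset.card_pos.mpr ⟨v, hvσ⟩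
        exact ⟨Finset.subset_insert_iff.mpr h1, by omega⟩
      · have h1 : c - bd (cone v w) = cone v (y + bd w) := by
          have := bd_cone v w
          rw [map_add, eq_sub_of_add_eq this]
          nth_rewrite 1 [hcw]
          abel
        rw [h1] at hσ
        have hvσ : v ∈ σ := by
          by_contra h
          simp [cone_apply, h] at hσ
        have h2 : bd c (σ.erase v) ≠ 0 := by
          intro h0
          apply hσ
          rw [cone_apply, if_pos hvσ]
          have h3 : bd c = y - cone v (bd y) + bd w := by
            nth_rewrite 1 [hcw]
            rw [map_add, eq_sub_of_add_eq (bd_cone v y)]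
          rw [h3] at h0
          have h4 : cone v (bd y) (σ.erase v) = 0 := by simp [cone_apply]
          simp only [Pi.add_apply, Pi.sub_apply, h4, sub_zero] at h0 ⊢
          rw [h0, mul_zero]
        have h3 := hbd _ h2
        rwa [hspan σ hvσ, hsup]
    -- Otherwise `link v c` is a relative cycle of the contraction; the induction hypothesis lets one
    -- remove it, and the remainder is a relative cycle on `G`.
    · have hlt : Module.finrank k S <
          Module.finrank k ↥(S ⊔ Submodule.span k {f v}) := by
        apply Submodule.finrank_lt_finrank_of_lt
        rwa [left_lt_sup, Submodule.span_singleton_le_iff_mem]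
      have hle := (S ⊔ Submodule.span k {f v}).finrank_le
      rcases Nat.eq_zero_or_pos s with hs0 | hs0
      · have := S.finrank_le
        omega
      obtain ⟨d₁, hd₁, hyd⟩ := ih (S ⊔ Submodule.span k {f v}) (s - 1) (by omega) y
        (fun σ hσ => ⟨(hyG σ hσ).1, by have := (hyG σ hσ).2; omega⟩) (by
          intro σ hσ
          rw [hy, bd_link] at hσ
          have hvσ : v ∉ σ := fun h => hσ (by simp [link_apply, h])
          have h := hbd (insert v σ) fun h => hσ (by simp [link_apply, h])
          rwa [hspan _ (Finset.mem_insert_self v σ), Finset.erase_insert hvσ] at h)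
      have hcone : ∀ σ, cone v (y - bd d₁) σ ≠ 0 → S ⊔ Submodule.span k (f '' σ) ≠ ⊤ := by
        intro σ hσ
        have hvσ : v ∈ σ := by
          by_contra h
          simp [cone_apply, h] at hσ
        rw [hspan σ hvσ]
        exact hyd _ fun h => hσ (by rw [cone_apply, h]; simp)
      have hsplit : c + bd (cone v d₁) = cone v (y - bd d₁) + (w + d₁) := by
        rw [map_sub, eq_sub_of_add_eq (bd_cone v d₁)]
        nth_rewrite 1 [hcw]
        abel
      obtain ⟨d₂, hd₂, hwd⟩ := ih S s hs (w + d₁) (by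
          intro σ hσ
          by_cases h : w σ = 0
          · have h1 := hd₁ σ (by simpa [h] using hσ)
            exact ⟨h1.1, by omega⟩
          · exact hwG σ h) (by
          intro σ hσ
          have h1 : bd (w + d₁) = bd c - bd (cone v (y - bd d₁)) := by
            rw [eq_sub_iff_add_eq', ← map_add, ← hsplit, map_add, bd_bd, add_zero]
          rw [h1] at hσ
          by_cases h : bd c σ = 0
          · exact hdown _ hcone σ (by rwa [Pi.sub_apply, h, zero_sub, neg_ne_zero] at hσ)
          · exact hbd σ h)
      refine ⟨d₂ - cone v d₁, fun σ hσ => ?_, fun σ hσ => ?_⟩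
      · by_cases h : d₂ σ = 0
        · have h1 : cone v d₁ σ ≠ 0 := by simpa [h] using hσ
          have hvσ : v ∈ σ := by
            by_contra h
            simp [cone_apply, h] at h1
          obtain ⟨h2, h3⟩ := hd₁ (σ.erase v) fun h => h1 (by simp [cone_apply, h])
          rw [Finset.card_erase_of_mem hvσ] at h3
          have := Finset.card_pos.mpr ⟨v, hvσ⟩
          exact ⟨Finset.subset_insert_iff.mpr h2, by omega⟩
        · exact ⟨(hd₂ σ h).1.trans (Finset.subset_insert v G), (hd₂ σ h).2⟩
      · have h1 : c - bd (d₂ - cone v d₁) = cone v (y - bd d₁) + (w + d₁ - bd d₂) := by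
          rw [map_sub, ← sub_add, sub_add_eq_add_sub, hsplit]
          abel
        rw [h1] at hσ
        by_cases h : cone v (y - bd d₁) σ = 0
        · exact hwd σ (by rwa [Pi.add_apply, h, zero_add] at hσ)
        · exact hcone σ h

end Spanning

/-! ### Acyclicity of a clique complex in high degrees -/

section Core

open IsLocalRing TensorProduct

/-- A finitely generated module over a valuation ring inside a vector space over the fraction field
is free, so that its reduction has at most the dimension of the ambient space. -/
lemma finrank_residueField_tensorProduct_le {R F E : Type*} [CommRing R] [IsDomain R]
    [ValuationRing R] [Field F] [Algebra R F] [IsFractionRing R F] [AddCommGroup E] [Module R E]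
    [Module F E] [IsScalarTower R F E] [FiniteDimensional F E] (Λ : Submodule R E) (hΛ : Λ.FG) :
    Module.finrank (ResidueField R) (ResidueField R ⊗[R] Λ) ≤ Module.finrank F E := by
  have : Module.Finite R Λ := Module.Finite.iff_fg.mpr hΛ
  have : Module.IsTorsionFree R E := Module.IsTorsionFree.trans_faithfulSMul R F E
  have : Module.Flat R Λ := Module.Flat.flat_iff_torsion_eq_bot_of_isBezout.mpr
    ((Submodule.isTorsionFree_iff_torsion_eq_bot (R := R) (M := Λ)).mp inferInstance)
  have : Module.Free R Λ := Module.free_of_flat_of_isLocalRing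
  rw [Module.finrank_baseChange, IsFractionRing.finrank_right_eq (R := R) (S := F) (N := E)]
  exact Cardinal.toNat_le_toNat (Submodule.rank_le Λ) (by
    rw [← IsFractionRing.rank_right_eq (R := R) (S := F) (N := E)]
    exact Module.rank_lt_aleph0 F E)

open Classical in
/-- The image of `g v` in the reduction `Λ ⊗ k` of a lattice `Λ` (zero if `g v ∉ Λ`). -/
noncomputable def reduction {V R E : Type*} [CommRing R] [IsLocalRing R] [AddCommGroup E] [Module R E]
    (g : V → E) (Λ : Submodule R E) (v : V) : ResidueField R ⊗[R] Λ :=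
  if h : g v ∈ Λ then 1 ⊗ₜ ⟨g v, h⟩ else 0

/-- Nakayama's lemma: a family generates a lattice exactly when its reduction spans. -/
lemma span_reduction_eq_top_iff {V R E : Type*} [CommRing R] [IsLocalRing R] [AddCommGroup E]
    [Module R E] (g : V → E) (Λ : Submodule R E) (hΛ : Λ.FG) (τ : Set V)
    (hτ : ∀ v ∈ τ, g v ∈ Λ) :
    Submodule.span (ResidueField R) (reduction g Λ '' τ) = ⊤ ↔
      Submodule.span R (g '' τ) = Λ := by
  have : Module.Finite R Λ := Module.Finite.iff_fg.mpr hΛ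
  set S : Set Λ := Λ.subtype ⁻¹' (g '' τ) with hS
  have h1 : TensorProduct.mk R (ResidueField R) Λ 1 '' S = reduction g Λ '' τ := by
    ext x
    constructor
    · rintro ⟨y, ⟨v, hv, hvy⟩, rfl⟩
      refine ⟨v, hv, ?_⟩
      rw [reduction, dif_pos (hτ v hv)]
      congr 1
      exact Subtype.ext hvy
    · rintro ⟨v, hv, rfl⟩
      refine ⟨⟨g v, hτ v hv⟩, ⟨v, hv, rfl⟩, ?_⟩
      rw [reduction, dif_pos (hτ v hv)]
      rfl
  have h2 : (Submodule.span R S).map Λ.subtype = Submodule.span R (g '' τ) := by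
    rw [Submodule.map_span, hS, Set.image_preimage_eq_of_subset]
    rintro _ ⟨v, hv, rfl⟩
    exact ⟨⟨g v, hτ v hv⟩, rfl⟩
  rw [← Submodule.restrictScalars_eq_top_iff R, Submodule.restrictScalars_span R _
    residue_surjective, ← h1, ← Submodule.map_span, map_tensorProduct_mk_eq_top, ← h2]
  constructor
  · intro h
    rw [h, Submodule.map_top, Submodule.range_subtype]
  · intro h
    apply Submodule.map_injective_of_injective Λ.injective_subtype
    rw [h, Submodule.map_top, Submodule.range_subtype]

/-- All pairs of elements of `σ`, equal pairs included, are in the relation `A`. -/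
def IsClique {V : Type*} (A : V → V → Prop) (σ : Finset V) : Prop := ∀ u ∈ σ, ∀ v ∈ σ, A u v

lemma IsClique.mono {V : Type*} {A : V → V → Prop} {σ τ : Finset V} (h : IsClique A τ)
    (hστ : σ ⊆ τ) : IsClique A σ := fun u hu v hv => h u (hστ hu) v (hστ hv)

variable {V : Type*} [LinearOrder V] [Fintype V]

/-- Let `g` map the vertices to a vector space `E`, and assume that two vertices related to all
elements of a clique `σ` and mapped into the lattice generated by `g '' σ` are related to each
other. Then every cycle made of cliques with more than `dim E` elements bounds a chain of cliques.

Cliques are graded by the lattices `hull σ` that they generate. The cliques with a given maximal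
hull fall into classes, each of which consists of the generating subsets of one largest clique `G`;
hence the part of the cycle in one class is a relative cycle of the simplex on `G` modulo
non-generating sets, and `exists_sub_bd_nonspanning` pushes it to smaller hulls. -/
theorem exists_bd_eq_of_isClique {R F E : Type*} [CommRing R] [IsDomain R] [ValuationRing R]
    [Field F] [Algebra R F] [IsFractionRing R F] [AddCommGroup E] [Module R E] [Module F E]
    [IsScalarTower R F E] [FiniteDimensional F E] (g : V → E) (A : V → V → Prop)
    (htwin : ∀ σ : Finset V, IsClique A σ → ∀ u v,
      g u ∈ Submodule.span R (g '' σ) → g v ∈ Submodule.span R (g '' σ) →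
      (∀ a ∈ σ, A u a) → (∀ a ∈ σ, A v a) → A u v)
    (s : ℕ) (hs : Module.finrank F E < s) (c : Finset V → ℤ)
    (hc : ∀ σ, c σ ≠ 0 → IsClique A σ ∧ σ.card = s) (hbd : bd c = 0) :
    ∃ d : Finset V → ℤ, (∀ σ, d σ ≠ 0 → IsClique A σ ∧ σ.card = s + 1) ∧ bd d = c := by
  classical
  set hull : Finset V → Submodule R E := fun σ => Submodule.span R (g '' σ) with hhull
  have hull_mono : ∀ {σ τ : Finset V}, σ ⊆ τ → hull σ ≤ hull τ := fun h =>
    Submodule.span_mono (Set.image_mono (by exact_mod_cast h))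
  have mem_hull : ∀ {σ : Finset V} {v : V}, v ∈ σ → g v ∈ hull σ := fun h =>
    Submodule.subset_span ⟨_, by exact_mod_cast h, rfl⟩
  -- The induction is on a set `𝒯` of cliques that contains the support of the cycle and is closed
  -- under passing to cliques with a smaller hull.
  suffices H : ∀ 𝒯 : Finset (Finset V), (∀ τ ∈ 𝒯, IsClique A τ) →
      (∀ τ ∈ 𝒯, ∀ ρ, IsClique A ρ → hull ρ < hull τ → ρ ∈ 𝒯) →
      ∀ c : Finset V → ℤ, (∀ σ, c σ ≠ 0 → σ ∈ 𝒯 ∧ σ.card = s) → bd c = 0 →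
      ∃ d : Finset V → ℤ, (∀ σ, d σ ≠ 0 → IsClique A σ ∧ σ.card = s + 1) ∧ bd d = c from
    H (Finset.univ.filter (IsClique A)) (by simp) (by simp +contextual) c (by simpa using hc) hbd
  clear hbd hc c
  intro 𝒯
  induction 𝒯 using Finset.strongInduction with
  | H 𝒯 ih =>
  intro hclique hclosed c hc hbd
  by_cases hc0 : c = 0
  · exact ⟨0, by simp, by simp [hc0]⟩
  obtain ⟨σ₀, hσ₀⟩ := Function.ne_iff.mp hc0
  obtain ⟨σ, hσ, hmax⟩ := 𝒯.exists_maximalFor hull ⟨σ₀, (hc σ₀ hσ₀).1⟩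
  have hmax' : ∀ τ ∈ 𝒯, hull σ ≤ hull τ → hull τ = hull σ := fun τ hτ h => (hmax hτ h).antisymm h
  -- The largest clique containing `σ` on which `hull` is not larger than on `σ`.
  set G : Finset V := Finset.univ.filter fun v => g v ∈ hull σ ∧ ∀ a ∈ σ, A v a with hG
  have hσG : σ ⊆ G := fun v hv => by
    simp only [hG, Finset.mem_filter, Finset.mem_univ, true_and]
    exact ⟨mem_hull hv, hclique σ hσ v hv⟩
  have hGclique : IsClique A G := by
    intro u hu v hv
    simp only [hG, Finset.mem_filter, Finset.mem_univ, true_and] at hu hv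
    exact htwin σ (hclique σ hσ) u v hu.1 hv.1 hu.2 hv.2
  have hGhull : ∀ v ∈ G, g v ∈ hull σ := fun v hv => (Finset.mem_filter.mp hv).2.1
  have hull_le : ∀ {τ : Finset V}, τ ⊆ G → hull τ ≤ hull σ := by
    intro τ hτ
    refine Submodule.span_le.mpr ?_
    rintro _ ⟨v, hv, rfl⟩
    exact hGhull v (hτ (by exact_mod_cast hv))
  have hfg : (hull σ).FG := Submodule.fg_span (Set.toFinite _)
  have hspan : ∀ τ : Finset V, τ ⊆ G →
      ((⊥ : Submodule (ResidueField R) (ResidueField R ⊗[R] hull σ)) ⊔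
        Submodule.span (ResidueField R) (reduction g (hull σ) '' τ) ≠ ⊤ ↔ hull τ ≠ hull σ) := by
    intro τ hτ
    rw [bot_sup_eq, Ne, span_reduction_eq_top_iff g (hull σ) hfg τ
      fun v hv => hGhull v (hτ (by exact_mod_cast hv))]
  -- The part of the cycle in the class of `G`. A face with hull `hull σ` of a simplex outside this
  -- class is itself outside the class, so that the boundary of `c₁` is non-generating.
  set c₁ : Finset V → ℤ := fun τ => if hull τ = hull σ ∧ τ ⊆ G then c τ else 0 with hc₁
  have hc₁G : ∀ τ, c₁ τ ≠ 0 → τ ⊆ G ∧ τ.card = s := by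
    intro τ hτ
    simp only [hc₁, ne_eq, ite_eq_right_iff, not_forall] at hτ
    exact ⟨hτ.1.2, (hc τ hτ.2).2⟩
  have hbd₁ : ∀ ρ, bd c₁ ρ ≠ 0 → ρ ⊆ G ∧ hull ρ ≠ hull σ := by
    intro ρ hρ
    have hρG : ρ ⊆ G := by
      obtain ⟨v, -, hv⟩ := exists_insert_of_bd_ne_zero hρ
      exact (Finset.subset_insert v ρ).trans (hc₁G _ hv).1
    refine ⟨hρG, fun hρσ => hρ ?_⟩
    rw [← Pi.zero_apply (M := fun _ => ℤ) ρ, ← hbd, bd_apply, bd_apply]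
    refine Finset.sum_congr rfl fun v _ => ?_
    by_cases hv : v ∈ ρ
    · rw [if_pos hv, if_pos hv]
    rw [if_neg hv, if_neg hv]
    congr 1
    simp only [hc₁]
    by_cases hcv : c (insert v ρ) = 0
    · rw [hcv, ite_self]
    rw [if_pos]
    have hmem := (hc _ hcv).1
    have hle : hull ρ ≤ hull (insert v ρ) := hull_mono (Finset.subset_insert v ρ)
    have heq : hull (insert v ρ) = hull σ := hmax' _ hmem (hρσ ▸ hle)
    refine ⟨heq, Finset.insert_subset ?_ hρG⟩
    have hgv : g v ∈ hull ρ := by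
      rw [hρσ, ← heq]
      exact mem_hull (Finset.mem_insert_self v ρ)
    simp only [hG, Finset.mem_filter, Finset.mem_univ, true_and]
    refine ⟨hρσ ▸ hgv, fun a ha => ?_⟩
    have hins := hclique _ hmem
    exact htwin ρ (hins.mono (Finset.subset_insert v ρ)) v a hgv
      (show g a ∈ hull ρ from hρσ ▸ mem_hull ha)
      (fun b hb => hins v (Finset.mem_insert_self v ρ) b (Finset.mem_insert_of_mem hb))
      (fun b hb => hGclique a (hσG ha) b (hρG hb))
  have : Module.Finite R (hull σ) := Module.Finite.iff_fg.mpr hfg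
  obtain ⟨d₁, hd₁, hcd⟩ := exists_sub_bd_nonspanning (reduction g (hull σ)) G
    (⊥ : Submodule (ResidueField R) (ResidueField R ⊗[R] hull σ)) s
    (by
      rw [finrank_bot, zero_add]
      exact (finrank_residueField_tensorProduct_le (F := F) (hull σ) hfg).trans_lt hs)
    c₁ hc₁G (fun ρ hρ => (hspan ρ (hbd₁ ρ hρ).1).mpr (hbd₁ ρ hρ).2)
  obtain ⟨d₂, hd₂, hcd₂⟩ := ih (𝒯.filter fun τ => ¬ (hull τ = hull σ ∧ τ ⊆ G))
    (Finset.filter_ssubset.mpr ⟨σ, hσ, by simp [hσG]⟩)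
    (fun τ hτ => hclique τ (Finset.mem_filter.mp hτ).1)
    (by
      intro τ hτ ρ hρ hlt
      have hτ' := (Finset.mem_filter.mp hτ).1
      refine Finset.mem_filter.mpr ⟨hclosed τ hτ' ρ hρ hlt, fun h => ?_⟩
      exact hlt.ne (h.1.trans (hmax' τ hτ' (h.1 ▸ hlt.le)).symm))
    (c - bd d₁)
    (by
      intro τ hτ
      by_cases h : (c₁ - bd d₁) τ = 0
      · have h1 : c₁ τ ≠ c τ := by
          intro h1
          rw [Pi.sub_apply] at h hτ
          exact hτ (h1 ▸ h)
        simp only [hc₁, ne_eq, ite_eq_left_iff, not_forall] at h1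
        obtain ⟨h1, h2⟩ := h1
        obtain ⟨h3, h4⟩ := hc τ (Ne.symm h2)
        exact ⟨Finset.mem_filter.mpr ⟨h3, h1⟩, h4⟩
      · have hτG : τ ⊆ G ∧ τ.card = s := by
          by_cases h1 : c₁ τ = 0
          · rw [Pi.sub_apply, h1, zero_sub, ← Ne, neg_ne_zero] at h
            obtain ⟨v, hvτ, hv⟩ := exists_insert_of_bd_ne_zero h
            obtain ⟨h2, h3⟩ := hd₁ _ hv
            rw [Finset.card_insert_of_notMem hvτ] at h3
            exact ⟨(Finset.subset_insert v τ).trans h2, by omega⟩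
          · exact hc₁G τ h1
        have hne := (hspan τ hτG.1).mp (hcd τ h)
        exact ⟨Finset.mem_filter.mpr ⟨hclosed σ hσ τ (hGclique.mono hτG.1)
          (lt_of_le_of_ne (hull_le hτG.1) hne), fun h => hne h.1⟩, hτG.2⟩)
    (by rw [map_sub, hbd, bd_bd, sub_zero])
  refine ⟨d₁ + d₂, fun τ hτ => ?_, by rw [map_add, hcd₂, add_sub_cancel]⟩
  by_cases h : d₁ τ = 0
  · exact hd₂ τ (by simpa [h] using hτ)
  · exact ⟨hGclique.mono (hd₁ τ h).1, (hd₁ τ h).2⟩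

end Core

/-! ### The volume of a chain -/

section Volume

variable {V : Type*} [LinearOrder V]

/-- The determinant of the `n` points attached to the vertices of `σ`, taken in increasing order
(zero if `σ` does not have `n` vertices). -/
def faceDet {R : Type*} [CommRing R] {n : ℕ} (p : V → Fin n → R) (σ : Finset V) : R :=
  if h : σ.card = n then (Matrix.of fun i j : Fin n => p (σ.orderEmbOfFin h j) i).det else 0

lemma map_faceDet {R R' : Type*} [CommRing R] [CommRing R'] (φ : R →+* R') {n : ℕ}
    (p : V → Fin n → R) (σ : Finset V) :
    φ (faceDet p σ) = faceDet (fun v i => φ (p v i)) σ := by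
  unfold faceDet
  split_ifs with h
  · rw [RingHom.map_det]; rfl
  · exact map_zero φ

lemma orderSign_orderEmbOfFin {n : ℕ} (σ : Finset V) (h : σ.card = n) (j : Fin n) :
    orderSign (σ.orderEmbOfFin h j) σ = (-1) ^ (j : ℕ) := by
  unfold orderSign
  congr 1
  have : σ.filter (· < σ.orderEmbOfFin h j) =
      (Finset.Iio j).map (σ.orderEmbOfFin h).toEmbedding := by
    ext v
    simp only [Finset.mem_filter, Finset.mem_map, Finset.mem_Iio]
    constructor
    · rintro ⟨hv, hlt⟩
      obtain ⟨k, rfl⟩ : v ∈ Set.range (σ.orderEmbOfFin h) := by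
        rw [Finset.range_orderEmbOfFin]; exact_mod_cast hv
      exact ⟨k, (σ.orderEmbOfFin h).lt_iff_lt.mp hlt, rfl⟩
    · rintro ⟨k, hk, rfl⟩
      exact ⟨σ.orderEmbOfFin_mem h k, (σ.orderEmbOfFin h).lt_iff_lt.mpr hk⟩
  rw [this, Finset.card_map, Fin.card_Iio]

/-- Up to the factor `n!`, the boundary of an `n`-simplex has the oriented volume of the simplex. -/
lemma sum_orderSign_mul_faceDet {R : Type*} [CommRing R] {n : ℕ} (p : V → Fin n → R)
    (σ : Finset V) (h : σ.card = n + 1) :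
    ∑ v ∈ σ, (orderSign v σ : R) * faceDet p (σ.erase v) =
      (Matrix.of fun j k : Fin n => p (σ.orderEmbOfFin h j.succ) k -
        p (σ.orderEmbOfFin h 0) k).det := by
  set f := σ.orderEmbOfFin h with hf
  have h1 : ∀ j : Fin (n + 1), faceDet p (σ.erase (f j)) =
      (Matrix.of fun a b : Fin n => p (f (j.succAbove a)) b).det := by
    intro j
    have hcard : (σ.erase (f j)).card = n := by
      rw [Finset.card_erase_of_mem (σ.orderEmbOfFin_mem h j), h, Nat.add_sub_cancel]
    have h2 : (fun a => f (j.succAbove a)) = (σ.erase (f j)).orderEmbOfFin hcard := by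
      apply Finset.orderEmbOfFin_unique
      · intro a
        refine Finset.mem_erase.mpr ⟨?_, σ.orderEmbOfFin_mem h _⟩
        exact fun he => Fin.succAbove_ne j a (f.injective he)
      · exact f.strictMono.comp (Fin.strictMono_succAbove j)
    rw [faceDet, dif_pos hcard, ← Matrix.det_transpose]
    congr 1
    ext a b
    simp only [Matrix.transpose_apply, Matrix.of_apply, ← h2]
  have h3 : ∑ v ∈ σ, (orderSign v σ : R) * faceDet p (σ.erase v) =
      ∑ j : Fin (n + 1), (orderSign (f j) σ : R) * faceDet p (σ.erase (f j)) := by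
    conv_lhs => rw [← Finset.map_orderEmbOfFin_univ σ h]
    rw [Finset.sum_map]
    refine Finset.sum_congr rfl fun j _ => ?_
    rw [Finset.map_orderEmbOfFin_univ]
    rfl
  set N : Matrix (Fin (n + 1)) (Fin (n + 1)) R :=
    Matrix.of fun j => Matrix.vecCons 1 (p (f j)) with hN
  set N' : Matrix (Fin (n + 1)) (Fin (n + 1)) R :=
    Matrix.of fun j k => N j k - (if j = 0 then 0 else 1) * N 0 k with hN'
  have h4 : N.det = N'.det := by
    refine Matrix.det_eq_of_forall_row_eq_smul_add_const (fun j => if j = 0 then 0 else 1) 0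
      (by simp) fun i j => ?_
    simp [hN']
  rw [h3]
  trans N.det
  · rw [Matrix.det_succ_column_zero]
    refine Finset.sum_congr rfl fun j _ => ?_
    rw [h1, orderSign_orderEmbOfFin]
    simp only [hN, Matrix.of_apply, Matrix.cons_val_zero, mul_one, Int.cast_pow, Int.cast_neg,
      Int.cast_one]
    rfl
  · rw [h4, Matrix.det_succ_column_zero, Finset.sum_eq_single_of_mem 0 (Finset.mem_univ _)]
    · simp only [hN', hN, Fin.val_zero, pow_zero, one_mul, Matrix.of_apply, if_true, zero_mul,
        sub_zero, Matrix.cons_val_zero]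
      congr 1
      ext j k
      simp
    · intro j _ hj
      simp [hN', hN, hj]

variable [Fintype V]

/-- The generalized oriented volume of the cone over a chain, multiplied by `n!`. -/
def chainVolume {R : Type*} [CommRing R] {n : ℕ} (p : V → Fin n → R) (c : Finset V → ℤ) : R :=
  ∑ σ, (c σ : R) * faceDet p σ

lemma chainVolume_add {R : Type*} [CommRing R] {n : ℕ} (p : V → Fin n → R)
    (c d : Finset V → ℤ) : chainVolume p (c + d) = chainVolume p c + chainVolume p d := by
  simp [chainVolume, add_mul, Finset.sum_add_distrib]

lemma chainVolume_sub {R : Type*} [CommRing R] {n : ℕ} (p : V → Fin n → R)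
    (c d : Finset V → ℤ) : chainVolume p (c - d) = chainVolume p c - chainVolume p d := by
  simp [chainVolume, sub_mul, Finset.sum_sub_distrib]

lemma map_chainVolume {R R' : Type*} [CommRing R] [CommRing R'] (φ : R →+* R') {n : ℕ}
    (p : V → Fin n → R) (c : Finset V → ℤ) :
    φ (chainVolume p c) = chainVolume (fun v i => φ (p v i)) c := by
  simp [chainVolume, map_faceDet]

lemma chainVolume_bd {R : Type*} [CommRing R] {n : ℕ} (p : V → Fin n → R) (d : Finset V → ℤ) :
    chainVolume p (bd d) =
      ∑ σ, (d σ : R) * ∑ v ∈ σ, (orderSign v σ : R) * faceDet p (σ.erase v) := by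
  have h1 : ∀ ρ : Finset V, ((bd d ρ : ℤ) : R) * faceDet p ρ =
      ∑ v, if v ∉ ρ then (d (insert v ρ) : R) * ((orderSign v ρ : R) * faceDet p ρ) else 0 := by
    intro ρ
    simp only [bd_apply, Int.cast_sum, Finset.sum_mul, ite_not]
    refine Finset.sum_congr rfl fun v _ => ?_
    split_ifs
    · simp
    · push_cast; ring
  have h2 : ∀ σ : Finset V,
      (d σ : R) * ∑ v ∈ σ, (orderSign v σ : R) * faceDet p (σ.erase v) =
      ∑ v, if v ∈ σ then (d σ : R) * ((orderSign v σ : R) * faceDet p (σ.erase v)) else 0 := by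
    intro σ
    rw [Finset.mul_sum, Finset.sum_ite_mem, Finset.univ_inter]
  simp only [chainVolume, h1, h2]
  rw [Finset.sum_comm, Finset.sum_comm (s := (Finset.univ : Finset (Finset V)))]
  refine Finset.sum_congr rfl fun v _ => ?_
  rw [← Finset.sum_filter, ← Finset.sum_filter]
  refine Finset.sum_nbij' (insert v) (fun σ => σ.erase v) ?_ ?_ ?_ ?_ ?_
  · simp
  · simp
  · intro σ hσ; exact Finset.erase_insert (by simpa using hσ)
  · intro σ hσ; exact Finset.insert_erase (by simpa using hσ)
  · intro σ hσ
    rw [Finset.erase_insert (by simpa using hσ), orderSign_insert_self]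

end Volume

/-! ### Isotropic coordinates -/

section Isotropic

/-- The sum of `n` squares restricts to the square of one linear form on the common kernel of at
most `n / 2` linear forms: `x₀² + x₁²` vanishes where `x₀ + i x₁` does. -/
lemma exists_linearMap_isotropic {F : Type*} [Field F] (i : F) (hi : i ^ 2 = -1) (n : ℕ) :
    ∃ d ≤ n / 2, ∃ (y : (Fin n → F) →ₗ[F] (Fin d → F)) (t : (Fin n → F) →ₗ[F] F),
      ∀ u, y u = 0 → u ⬝ᵥ u = t u ^ 2 := by
  induction n using Nat.twoStepInduction with
  | zero => exact ⟨0, le_rfl, 0, 0, fun u _ => by simp [dotProduct]⟩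
  | one => exact ⟨0, Nat.zero_le _, 0, LinearMap.proj 0, fun u _ => by simp [dotProduct, sq]⟩
  | more n ih _ =>
    obtain ⟨d, hd, y, t, hyt⟩ := ih
    let shift : (Fin (n + 2) → F) →ₗ[F] (Fin n → F) := LinearMap.funLeft F F fun j => j.succ.succ
    refine ⟨d + 1, by omega, LinearMap.pi (Fin.cons (LinearMap.proj 0 + i • LinearMap.proj 1)
      fun j => LinearMap.proj j ∘ₗ y ∘ₗ shift), t ∘ₗ shift, fun u hu => ?_⟩
    have h0 : u 0 + i * u 1 = 0 := by simpa using congrFun hu 0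
    have h1 : y (shift u) = 0 := by
      ext j
      simpa using congrFun hu j.succ
    have h2 : u ⬝ᵥ u = u 0 * u 0 + u 1 * u 1 + shift u ⬝ᵥ shift u := by
      simp only [dotProduct, Fin.sum_univ_succ, shift, LinearMap.funLeft_apply]
      exact (add_assoc _ _ _).symm
    rw [h2, hyt _ h1, LinearMap.comp_apply, add_eq_right]
    linear_combination (u 0 - i * u 1) * h0 + u 1 ^ 2 * hi

end Isotropic

/-! ### Points of a valued field with integral orthogonal distances -/

section Clique

variable {F : Type*} [Field F] (O : ValuationSubring F)

lemma mem_of_sq_mem {x : F} (h : x ^ 2 ∈ O) : x ∈ O := by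
  rcases O.mem_or_inv_mem x with hx | hx
  · exact hx
  · by_cases h0 : x = 0
    · rw [h0]; exact O.zero_mem
    · have := O.mul_mem _ _ h hx
      rwa [sq, mul_assoc, mul_inv_cancel₀ h0, mul_one] at this

lemma det_mem {n : ℕ} (A : Matrix (Fin n) (Fin n) F) (h : ∀ i j, A i j ∈ O) : A.det ∈ O := by
  have : A = (Matrix.of fun i j => (⟨A i j, h i j⟩ : O)).map O.subtype := rfl
  rw [this, ← RingHom.mapMatrix_apply, ← RingHom.map_det]
  exact SetLike.coe_mem _

/-- The square of the orthogonal distance between `p u` and `p v` is an element of the valuation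
ring. -/
def IntegralDist {V : Type*} {n : ℕ} (p : V → Fin n → F) (u v : V) : Prop :=
  (p u - p v) ⬝ᵥ (p u - p v) ∈ O

variable {V : Type*} {n : ℕ} {p : V → Fin n → F}

/-- The polarization identity, with `o` as the origin. -/
lemma dotProduct_sub_mem (h2 : (2 : F)⁻¹ ∈ O) (h20 : (2 : F) ≠ 0) {a b o : V}
    (ha : IntegralDist O p a o) (hb : IntegralDist O p b o) (hab : IntegralDist O p a b) :
    (p a - p o) ⬝ᵥ (p b - p o) ∈ O := by
  have h : (p a - p o) ⬝ᵥ (p b - p o) = 2⁻¹ * ((p a - p o) ⬝ᵥ (p a - p o) +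
      (p b - p o) ⬝ᵥ (p b - p o) - (p a - p b) ⬝ᵥ (p a - p b)) := by
    rw [eq_inv_mul_iff_mul_eq₀ h20]
    simp only [sub_dotProduct, dotProduct_sub, dotProduct_comm (p b) (p a),
      dotProduct_comm (p o)]
    ring
  rw [h]
  exact O.mul_mem _ _ h2 (sub_mem (add_mem ha hb) hab)

/-- Two points `p u` and `p v` at integral distance from all points of a clique, and with isotropic
coordinates `y` in the affine lattice spanned by those of the clique, are at integral distance from
each other. Indeed each of them differs from an integral affine combination of the clique by a
vector of `ker y` that pairs integrally with the clique, and on `ker y` the quadratic form is the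
square of one linear form `t`. The first coordinate `1` turns affine combinations into
linear ones. -/
lemma integralDist_twin (h2 : (2 : F)⁻¹ ∈ O) (h20 : (2 : F) ≠ 0) {d : ℕ}
    (y : (Fin n → F) →ₗ[F] (Fin d → F)) (t : (Fin n → F) →ₗ[F] F)
    (hyt : ∀ u, y u = 0 → u ⬝ᵥ u = t u ^ 2) (σ : Finset V) (hσ : IsClique (IntegralDist O p) σ)
    (u v : V)
    (hu : ((1, y (p u)) : F × (Fin d → F)) ∈ Submodule.span O ((fun a => (1, y (p a))) '' σ))
    (hv : ((1, y (p v)) : F × (Fin d → F)) ∈ Submodule.span O ((fun a => (1, y (p a))) '' σ))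
    (hua : ∀ a ∈ σ, IntegralDist O p u a) (hva : ∀ a ∈ σ, IntegralDist O p v a) :
    IntegralDist O p u v := by
  obtain ⟨o, ho⟩ : σ.Nonempty := by
    by_contra h
    simp [Finset.not_nonempty_iff_eq_empty.mp h] at hu
  set X : V → Fin n → F := fun a => p a - p o with hX
  have hXX : ∀ a ∈ σ, ∀ b ∈ σ, X a ⬝ᵥ X b ∈ O := fun a ha b hb =>
    dotProduct_sub_mem O h2 h20 (hσ a ha o ho) (hσ b hb o ho) (hσ a ha b hb)
  have hright : ∀ x : Fin n → F, (∀ a ∈ σ, x ⬝ᵥ X a ∈ O) →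
      ∀ m ∈ Submodule.span O (X '' σ), x ⬝ᵥ m ∈ O := by
    intro x hx m hm
    induction hm using Submodule.span_induction with
    | mem m hm =>
      obtain ⟨a, ha, rfl⟩ := hm
      exact hx a ha
    | zero => rw [dotProduct_zero]; exact O.zero_mem
    | add m m' _ _ hm hm' => rw [dotProduct_add]; exact add_mem hm hm'
    | smul r m _ hm =>
      have : r • m = (r : F) • m := rfl
      rw [this, dotProduct_smul]
      exact O.mul_mem _ _ r.2 hm
  have hmm : ∀ m ∈ Submodule.span O (X '' σ), ∀ m' ∈ Submodule.span O (X '' σ),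
      m ⬝ᵥ m' ∈ O := by
    intro m hm
    refine hright m fun a ha => ?_
    rw [dotProduct_comm]
    exact hright (X a) (hXX a ha) m hm
  -- Relative to `o`, a point of the given kind is `m + z` with `m` in the lattice of the clique, and
  -- `z ∈ ker y` pairing integrally with this lattice and with `t z` integral.
  have key : ∀ w : V,
      ((1, y (p w)) : F × (Fin d → F)) ∈ Submodule.span O ((fun a => (1, y (p a))) '' σ) →
      (∀ a ∈ σ, IntegralDist O p w a) →
      ∃ m ∈ Submodule.span O (X '' σ), ∃ z, X w = m + z ∧ y z = 0 ∧ t z ∈ O ∧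
        ∀ m' ∈ Submodule.span O (X '' σ), z ⬝ᵥ m' ∈ O := by
    intro w hw hwa
    obtain ⟨c, hc⟩ := (Submodule.mem_span_image_finset_iff_exists_fun' O).mp hw
    have hc1 : ∑ a ∈ σ, (c a : F) = 1 := by
      have := congrArg Prod.fst hc
      rw [Prod.fst_sum] at this
      refine Eq.trans ?_ this
      exact Finset.sum_congr rfl fun a _ => (mul_one _).symm
    have hc2 : ∑ a ∈ σ, (c a : F) • y (p a) = y (p w) := by
      have := congrArg Prod.snd hc
      rwa [Prod.snd_sum] at this
    set m : Fin n → F := ∑ a ∈ σ, (c a : F) • X a with hm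
    have hmem : m ∈ Submodule.span O (X '' σ) :=
      sum_mem fun a ha => Submodule.smul_mem _ (c a) (Submodule.subset_span ⟨a, ha, rfl⟩)
    have hXw : ∀ m' ∈ Submodule.span O (X '' σ), X w ⬝ᵥ m' ∈ O :=
      hright _ fun a ha => dotProduct_sub_mem O h2 h20 (hwa o ho) (hσ a ha o ho) (hwa a ha)
    have hz : ∀ m' ∈ Submodule.span O (X '' σ), (X w - m) ⬝ᵥ m' ∈ O := fun m' hm' => by
      rw [sub_dotProduct]
      exact sub_mem (hXw m' hm') (hmm m hmem m' hm')
    have hyz : y (X w - m) = 0 := by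
      simp only [hm, hX, map_sub, map_sum, map_smul, smul_sub, Finset.sum_sub_distrib,
        ← Finset.sum_smul, hc1, hc2, one_smul]
      abel
    refine ⟨m, hmem, X w - m, by abel, hyz, mem_of_sq_mem O ?_, hz⟩
    rw [← hyt _ hyz]
    nth_rewrite 2 [sub_eq_add_neg]
    rw [dotProduct_add, dotProduct_neg, sub_dotProduct, dotProduct_comm m]
    exact add_mem (sub_mem (hwa o ho) (hXw m hmem)) (neg_mem (hz m hmem))
  obtain ⟨m, hm, z, hXu, hyz, htz, hz⟩ := key u hu hua
  obtain ⟨m', hm', z', hXv, hyz', htz', hz'⟩ := key v hv hva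
  have h1 : p u - p v = (m - m') + (z - z') := by
    have : p u - p v = X u - X v := by simp [hX]
    rw [this, hXu, hXv]
    abel
  have h3 := sub_mem hm hm'
  have h4 : (p u - p v) ⬝ᵥ (p u - p v) = (m - m') ⬝ᵥ (m - m') +
      2 * (z ⬝ᵥ (m - m') - z' ⬝ᵥ (m - m')) + (t z - t z') ^ 2 := by
    rw [h1, ← map_sub, ← hyt (z - z') (by rw [map_sub, hyz, hyz', sub_zero]), ← sub_dotProduct,
      add_dotProduct, dotProduct_add, dotProduct_add, dotProduct_comm (m - m') (z - z')]
    ring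
  rw [IntegralDist, h4]
  have h5 : (2 : F) ∈ O := by
    rw [← one_add_one_eq_two]
    exact add_mem O.one_mem O.one_mem
  exact add_mem (add_mem (hmm _ h3 _ h3) (O.mul_mem _ _ h5 (sub_mem (hz _ h3) (hz' _ h3))))
    (pow_mem (sub_mem htz htz') 2)

lemma edge_det_mem (h2 : (2 : F)⁻¹ ∈ O) (h20 : (2 : F) ≠ 0) {σ : Finset V}
    (hσ : IsClique (IntegralDist O p) σ) (f : Fin (n + 1) → V) (hf : ∀ j, f j ∈ σ) :
    (Matrix.of fun j k : Fin n => p (f j.succ) k - p (f 0) k).det ∈ O := by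
  apply mem_of_sq_mem
  set D : Matrix (Fin n) (Fin n) F := Matrix.of fun j k => p (f j.succ) k - p (f 0) k with hD
  have h : D.det ^ 2 = (D * D.transpose).det := by
    rw [Matrix.det_mul, Matrix.det_transpose, sq]
  rw [h]
  refine det_mem O _ fun j k => ?_
  exact dotProduct_sub_mem O h2 h20 (hσ _ (hf _) _ (hf 0)) (hσ _ (hf _) _ (hf 0))
    (hσ _ (hf _) _ (hf _))

/-- The volume of a cycle of dimension `n - 1 ≥ 2` is integral if all edges of its simplices have
integral squared lengths. Here `n ≥ 3` gives `n / 2 + 1 < n`, as `exists_bd_eq_of_isClique` needs: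
the cycle bounds a chain of `n`-simplices with integral edges, whose volumes are integral by the
Gram determinant (`edge_det_mem`). -/
theorem chainVolume_mem [LinearOrder V] [Fintype V] (h2 : (2 : F)⁻¹ ∈ O) (h20 : (2 : F) ≠ 0)
    (i : F) (hi : i ^ 2 = -1) (hn : 3 ≤ n) (c : Finset V → ℤ)
    (hc : ∀ σ, c σ ≠ 0 → IsClique (IntegralDist O p) σ ∧ σ.card = n) (hbd : bd c = 0) :
    chainVolume p c ∈ O := by
  obtain ⟨d, hd, y, t, hyt⟩ := exists_linearMap_isotropic i hi n
  obtain ⟨e, he, rfl⟩ := exists_bd_eq_of_isClique (R := O) (F := F)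
    (fun a => ((1, y (p a)) : F × (Fin d → F))) (IntegralDist O p)
    (integralDist_twin O h2 h20 y t hyt) n
    (by rw [Module.finrank_prod, Module.finrank_self, Module.finrank_fin_fun]; omega) c hc hbd
  rw [chainVolume_bd]
  refine sum_mem fun σ _ => ?_
  by_cases hσ : e σ = 0
  · rw [hσ, Int.cast_zero, zero_mul]
    exact O.zero_mem
  · obtain ⟨h1, h3⟩ := he σ hσ
    rw [sum_orderSign_mul_faceDet p σ h3]
    exact O.mul_mem _ _ (intCast_mem O _) (edge_det_mem O h2 h20 h1 _ (σ.orderEmbOfFin_mem h3))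

end Clique

/-! ### From integrality to a uniform bound -/

section Ultrapower

open Filter

/-- The valuation ring of bounded elements in an ultrapower of `ℂ`. -/
def boundedGerms {ι : Type*} (φ : Ultrafilter ι) : ValuationSubring (Germ (φ : Filter ι) ℂ) where
  carrier := {x | ∃ C : ℝ, x.LiftPred fun z => ‖z‖ ≤ C}
  zero_mem' := ⟨0, Eventually.of_forall fun _ => by simp⟩
  one_mem' := ⟨1, Eventually.of_forall fun _ => by simp⟩
  add_mem' := by
    rintro x y ⟨C, hC⟩ ⟨D, hD⟩
    refine ⟨C + D, ?_⟩
    induction x using Germ.inductionOn with | _ f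
    induction y using Germ.inductionOn with | _ g
    filter_upwards [hC, hD] with k hf hg using (norm_add_le _ _).trans (add_le_add hf hg)
  mul_mem' := by
    rintro x y ⟨C, hC⟩ ⟨D, hD⟩
    refine ⟨C * D, ?_⟩
    induction x using Germ.inductionOn with | _ f
    induction y using Germ.inductionOn with | _ g
    filter_upwards [hC, hD] with k hf hg
    have : ‖f k * g k‖ ≤ C * D := by
      rw [norm_mul]
      exact mul_le_mul hf hg (norm_nonneg _) ((norm_nonneg _).trans hf)
    exact this
  neg_mem' := by
    rintro x ⟨C, hC⟩
    refine ⟨C, ?_⟩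
    induction x using Germ.inductionOn with | _ f
    filter_upwards [hC] with k hf using (norm_neg _).trans_le hf
  mem_or_inv_mem' := by
    intro x
    induction x using Germ.inductionOn with | _ f
    rcases φ.em fun k => ‖f k‖ ≤ 1 with h | h
    · exact Or.inl ⟨1, h⟩
    · refine Or.inr ⟨1, ?_⟩
      filter_upwards [h] with k hk
      have : ‖(f k)⁻¹‖ ≤ 1 := by
        rw [norm_inv]
        exact inv_le_one_of_one_le₀ (not_le.mp hk).le
      exact this

/-- If the volume were unbounded on configurations with edges of squared length at most `1`, a
sequence of such configurations would define a point configuration over an ultrapower of `ℂ` with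
bounded squared edge lengths but unbounded volume. -/
theorem exists_norm_chainVolume_le {V : Type*} [LinearOrder V] [Fintype V] {n : ℕ} (hn : 3 ≤ n)
    (c : Finset V → ℤ) (E : V → V → Prop)
    (hc : ∀ σ, c σ ≠ 0 → IsClique E σ ∧ σ.card = n) (hbd : bd c = 0) :
    ∃ C : ℝ, ∀ x : V → Fin n → ℂ, (∀ u v, E u v → ‖(x u - x v) ⬝ᵥ (x u - x v)‖ ≤ 1) →
      ‖chainVolume x c‖ ≤ C := by
  by_contra! hunbdd
  choose x hx hvol using fun k : ℕ => hunbdd k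
  let φ := hyperfilter ℕ
  let O := boundedGerms φ
  let X : V → Fin n → ℕ → ℂ := fun v j k => x k v j
  let ρ : (ℕ → ℂ) →+* Germ (φ : Filter ℕ) ℂ := Germ.coeRingHom _
  let p : V → Fin n → Germ (φ : Filter ℕ) ℂ := fun v j => ρ (X v j)
  have hp : ∀ u v, E u v → IntegralDist O p u v := by
    intro u v huv
    have h1 : (p u - p v) ⬝ᵥ (p u - p v) = ρ ((X u - X v) ⬝ᵥ (X u - X v)) := by
      simp [dotProduct, p]
    rw [IntegralDist, h1]
    refine ⟨1, Eventually.of_forall fun k => ?_⟩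
    convert hx k u v huv
    simp [dotProduct, X]
  have hchar : (2 : Germ (φ : Filter ℕ) ℂ) = ρ 2 := (map_ofNat ρ 2).symm
  have hmul : (ρ fun _ => (2 : ℂ)⁻¹) * 2 = 1 := by
    rw [hchar, ← map_mul, ← map_one ρ]
    congr 1
    ext k
    simp
  have h20 : (2 : Germ (φ : Filter ℕ) ℂ) ≠ 0 := right_ne_zero_of_mul_eq_one hmul
  have h2 : (2 : Germ (φ : Filter ℕ) ℂ)⁻¹ ∈ O := by
    rw [← eq_inv_of_mul_eq_one_left hmul]
    exact ⟨‖(2 : ℂ)⁻¹‖, Eventually.of_forall fun k => le_rfl⟩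
  have hi : (ρ fun _ => Complex.I) ^ 2 = -1 := by
    rw [← map_pow, ← map_one ρ, ← map_neg]
    congr 1
    ext k
    simp
  obtain ⟨C, hC⟩ := chainVolume_mem O h2 h20 (ρ fun _ => Complex.I) hi hn c
    (fun σ hσ => ⟨fun u hu v hv => hp u v ((hc σ hσ).1 u hu v hv), (hc σ hσ).2⟩) hbd
  rw [show chainVolume p c = ρ (chainVolume X c) from (map_chainVolume ρ X c).symm] at hC
  have hC' : ∀ᶠ k in (φ : Filter ℕ), ‖chainVolume X c k‖ ≤ C := hC
  obtain ⟨k, hk, hk'⟩ := (hC'.and (Nat.hyperfilter_le_atTop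
    ((eventually_ge_atTop ⌈C⌉₊)))).exists
  have h3 : chainVolume X c k = chainVolume (x k) c :=
    map_chainVolume (Pi.evalRingHom (fun _ => ℂ) k) X c
  rw [h3] at hk
  exact absurd (hvol k) (not_lt.mpr (hk.trans ((Nat.le_ceil C).trans (by exact_mod_cast hk'))))

lemma chainVolume_smul {V : Type*} [LinearOrder V] [Fintype V] {R : Type*} [CommRing R] {n : ℕ}
    (t : R) (x : V → Fin n → R) (c : Finset V → ℤ) :
    chainVolume (t • x) c = t ^ n * chainVolume x c := by
  have h : ∀ σ : Finset V, faceDet (t • x) σ = t ^ n * faceDet x σ := by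
    intro σ
    unfold faceDet
    split_ifs with h
    · have := Matrix.det_smul (Matrix.of fun i j : Fin n => x (σ.orderEmbOfFin h j) i) t
      rw [Fintype.card_fin] at this
      rw [← this]
      rfl
    · rw [mul_zero]
  simp only [chainVolume, h, Finset.mul_sum]
  exact Finset.sum_congr rfl fun σ _ => by ring

/-- The homogeneous form of `exists_norm_chainVolume_le`. -/
theorem exists_norm_chainVolume_le_mul_rpow {V : Type*} [LinearOrder V] [Fintype V] {n : ℕ}
    (hn : 3 ≤ n) (c : Finset V → ℤ) (E : V → V → Prop)
    (hc : ∀ σ, c σ ≠ 0 → IsClique E σ ∧ σ.card = n) (hbd : bd c = 0) :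
    ∃ C : ℝ, ∀ (x : V → Fin n → ℂ) (m : ℝ), 0 ≤ m →
      (∀ u v, E u v → ‖(x u - x v) ⬝ᵥ (x u - x v)‖ ≤ m) →
      ‖chainVolume x c‖ ≤ C * m ^ ((n : ℝ) / 2) := by
  obtain ⟨C, hC⟩ := exists_norm_chainVolume_le hn c E hc hbd
  refine ⟨C, fun x m hm hx => ?_⟩
  have hscale : ∀ t : ℝ, 0 ≤ t → t ^ 2 * m ≤ 1 → t ^ n * ‖chainVolume x c‖ ≤ C := by
    intro t ht htm
    have h1 := hC ((t : ℂ) • x) fun u v huv => by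
      rw [Pi.smul_apply, Pi.smul_apply, ← smul_sub, smul_dotProduct, dotProduct_smul, smul_eq_mul,
        smul_eq_mul, ← mul_assoc, ← sq, norm_mul, norm_pow, Complex.norm_real,
        Real.norm_of_nonneg ht]
      exact (mul_le_mul_of_nonneg_left (hx u v huv) (sq_nonneg t)).trans htm
    rwa [chainVolume_smul, norm_mul, norm_pow, Complex.norm_real, Real.norm_of_nonneg ht] at h1
  rcases hm.eq_or_lt with rfl | hm
  -- If all edges are isotropic, so are those of all dilated configurations, and their volumes would
  -- tend to infinity unless they vanish.
  · have hzero : chainVolume x c = 0 := by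
      by_contra h
      have hpos := norm_pos_iff.mpr h
      have hC0 : 0 ≤ C := by
        have := hscale 0 le_rfl (by simp)
        rwa [zero_pow (by omega), zero_mul] at this
      set t : ℝ := 1 + C / ‖chainVolume x c‖ with ht
      have ht1 : 1 ≤ t := le_add_of_nonneg_right (div_nonneg hC0 hpos.le)
      have h1 := hscale t (by linarith) (by simp)
      have h2 : t ≤ t ^ n := le_self_pow₀ ht1 (by omega)
      have h3 : t * ‖chainVolume x c‖ = ‖chainVolume x c‖ + C := by
        rw [ht]
        field_simp
      have h4 := mul_le_mul_of_nonneg_right h2 hpos.le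
      linarith
    rw [hzero, norm_zero, Real.zero_rpow (by positivity), mul_zero]
  · have hs : 0 < √m := Real.sqrt_pos.mpr hm
    have h1 := hscale (√m)⁻¹ (inv_nonneg.mpr hs.le) (by
      rw [inv_pow, Real.sq_sqrt hm.le, inv_mul_cancel₀ hm.ne'])
    rw [Real.rpow_div_two_eq_sqrt _ hm.le, Real.rpow_natCast]
    rwa [inv_pow, inv_mul_le_iff₀ (by positivity), mul_comm] at h1

end Ultrapower

/-! ### Simplicial chains of the simplex -/

section FaceChains

variable {M n : ℕ}

/-- The coefficient function on all sets of vertices of a chain of `Δ^M`. -/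
noncomputable def toChain (M n : ℕ) : FaceChain M n →ₗ[ℤ] (Finset (Fin (M + 1)) → ℤ) :=
  Finsupp.linearCombination ℤ fun σ => Pi.single σ.1 1

lemma toChain_apply (Z : FaceChain M n) (σ : Finset (Fin (M + 1))) :
    toChain M n Z σ = if h : σ.card = n then Z ⟨σ, h⟩ else 0 := by
  induction Z using Finsupp.induction_linear with
  | zero => simp
  | add Z Z' h h' =>
    rw [map_add, Pi.add_apply, h, h']
    split_ifs <;> simp
  | single τ a =>
    rw [toChain, Finsupp.linearCombination_single, Pi.smul_apply, Pi.single_apply]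
    by_cases h : σ = τ.1
    · subst h
      simp [τ.2]
    · rw [if_neg h]
      split_ifs with h'
      · rw [Finsupp.single_eq_of_ne, smul_zero]
        exact fun he => h (congrArg Subtype.val he)
      · simp

lemma bd_single {V : Type*} [LinearOrder V] [Fintype V] (σ : Finset V) :
    bd (Pi.single σ 1) = ∑ v ∈ σ, orderSign v σ • Pi.single (σ.erase v) 1 := by
  ext ρ
  rw [bd_apply, Finset.sum_apply, ← Finset.univ_inter σ, ← Finset.sum_ite_mem,
    Finset.univ_inter]
  refine Finset.sum_congr rfl fun v _ => ?_
  simp only [Pi.smul_apply, smul_eq_mul, Pi.single_apply]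
  by_cases hv : v ∈ ρ
  · have : ρ ≠ σ.erase v := by rintro rfl; simp at hv
    simp [hv, this]
  · by_cases h : insert v ρ = σ
    · subst h
      simp [hv, Finset.erase_insert hv, orderSign_insert_self]
    · have : v ∈ σ → ρ ≠ σ.erase v := by
        rintro hσ rfl
        exact h (Finset.insert_erase hσ)
      by_cases hσ : v ∈ σ <;> simp [hv, h, hσ, this]

lemma bd_toChain (Z : FaceChain M n) : bd (toChain M n Z) = toChain M (n - 1) (boundary M n Z) := by
  induction Z using Finsupp.induction_linear with
  | zero => simp
  | add Z Z' h h' => rw [map_add, map_add, h, h', map_add, map_add]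
  | single τ a =>
    rw [toChain, boundary, Finsupp.linearCombination_single, Finsupp.linearCombination_single,
      map_smul, map_smul, bd_single, map_sum, ← Finset.sum_coe_sort]
    congr 1
    refine Finset.sum_congr rfl fun v _ => ?_
    rw [toChain, Finsupp.linearCombination_single]
    rfl

lemma sum_support_eq_chainVolume {R : Type*} [CommRing R] (Z : FaceChain M n)
    (p : Fin (M + 1) → Fin n → R) :
    ∑ σ ∈ Z.support, (Z σ : R) * (Matrix.of fun i j => p (σ.1.orderEmbOfFin σ.2 j) i).det =
      chainVolume p (toChain M n Z) := by
  have h1 : ∑ σ ∈ Z.support,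
      (Z σ : R) * (Matrix.of fun i j => p (σ.1.orderEmbOfFin σ.2 j) i).det =
      ∑ σ : Face M n, (toChain M n Z σ.1 : R) * faceDet p σ.1 := by
    rw [← Finset.sum_subset (Finset.subset_univ Z.support)]
    · refine Finset.sum_congr rfl fun σ _ => ?_
      rw [toChain_apply, dif_pos σ.2, faceDet, dif_pos σ.2]
    · intro σ _ hσ
      rw [toChain_apply, dif_pos σ.2, Finsupp.notMem_support_iff.mp hσ, Int.cast_zero, zero_mul]
  rw [h1, ← Finset.sum_subtype (Finset.univ.filter fun σ => σ.card = n) (by simp)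
    fun σ => (toChain M n Z σ : R) * faceDet p σ]
  refine Finset.sum_filter_of_ne fun σ _ hσ => ?_
  by_contra h
  simp [faceDet, h] at hσ

lemma Polyhedron.volume_eq {Z : FaceChain M n} (P : Polyhedron Z) :
    P.volume = 1 / (n.factorial : ℂ) * chainVolume P.vertex (toChain M n Z) := by
  rw [Polyhedron.volume, sum_support_eq_chainVolume]

lemma Polyhedron.sqLength_eq {Z : FaceChain M n} (P : Polyhedron Z) (u v : Fin (M + 1)) :
    P.sqLength u v = (P.vertex u - P.vertex v) ⬝ᵥ (P.vertex u - P.vertex v) := by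
  simp [Polyhedron.sqLength, dotProduct, sq]

lemma Polyhedron.norm_sqLength_le {Z : FaceChain M n} (P : Polyhedron Z) {u v : Fin (M + 1)}
    (h : ({u, v} : Finset (Fin (M + 1))) ∈ supp Z) : ‖P.sqLength u v‖ ≤ P.maxSqLength := by
  classical
  rcases eq_or_ne u v with rfl | huv
  · simp [Polyhedron.sqLength]
  · have : ‖P.sqLength u v‖₊ ≤ P.maxSqLength := by
      unfold Polyhedron.maxSqLength
      exact Finset.le_sup (f := fun e : Fin (M + 1) × Fin (M + 1) => ‖P.sqLength e.1 e.2‖₊)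
        (b := (u, v)) (by simp [huv, h])
    exact_mod_cast this

theorem exists_norm_volume_le (hn : 3 ≤ n) (Z : FaceChain M n) (hZ : IsCycle Z) :
    ∃ C : ℝ, ∀ P : Polyhedron Z, ‖P.volume‖ ≤ C * (P.maxSqLength : ℝ) ^ ((n : ℝ) / 2) := by
  obtain ⟨C, hC⟩ := exists_norm_chainVolume_le_mul_rpow hn (toChain M n Z)
    (fun u v => ({u, v} : Finset (Fin (M + 1))) ∈ supp Z)
    (by
      intro σ hσ
      rw [toChain_apply] at hσ
      obtain ⟨h, hσ⟩ : ∃ h : σ.card = n, Z ⟨σ, h⟩ ≠ 0 := by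
        by_cases h : σ.card = n
        · exact ⟨h, by rwa [dif_pos h] at hσ⟩
        · simp [h] at hσ
      refine ⟨fun u hu v hv => ⟨⟨u, by simp⟩, ⟨σ, h⟩, hσ, ?_⟩, h⟩
      rw [Finset.insert_subset_iff, Finset.singleton_subset_iff]
      exact ⟨hu, hv⟩)
    (by rw [bd_toChain, show boundary M n Z = 0 from hZ, map_zero])
  refine ⟨‖1 / (n.factorial : ℂ)‖ * C, fun P => ?_⟩
  rw [P.volume_eq, norm_mul, mul_assoc]
  refine mul_le_mul_of_nonneg_left (hC _ _ P.maxSqLength.2 fun u v huv => ?_) (norm_nonneg _)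
  rw [← P.sqLength_eq]
  exact P.norm_sqLength_le huv

end FaceChains

/-! ### The isotropic quadrilateral -/

section Example

variable {M n : ℕ}

/-- The polyhedron with prescribed vertices `p v`, extended linearly in barycentric coordinates. -/
noncomputable def polyhedronOfVertices (Z : FaceChain M n) (p : Fin (M + 1) → Fin n → ℂ) :
    Polyhedron Z where
  toFun x := ∑ v, x.1 v • p v
  linear_on_simplices σ _ := ⟨(∑ v, (LinearMap.proj v : (Fin (M + 1) → ℝ) →ₗ[ℝ] ℝ).smulRight
    (p v)).toAffineMap, fun x _ => by simp⟩

lemma vertex_polyhedronOfVertices (Z : FaceChain M n) (p : Fin (M + 1) → Fin n → ℂ)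
    {v : Fin (M + 1)} (hv : {v} ∈ supp Z) : (polyhedronOfVertices Z p).vertex v = p v := by
  rw [Polyhedron.vertex, dif_pos hv]
  simp [polyhedronOfVertices, vertexPoint, Pi.single_apply]

/-- The edge `{u, v}` of `Δ^3`. -/
def edge (u v : Fin 4) (h : u ≠ v) : Face 3 2 := ⟨{u, v}, Finset.card_pair h⟩

/-- The cycle `0 → 1 → 2 → 3 → 0` of `Δ^3`. -/
noncomputable def quadrilateral : FaceChain 3 2 :=
  Finsupp.single (edge 0 1 (by decide)) 1 + Finsupp.single (edge 1 2 (by decide)) 1 +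
    Finsupp.single (edge 2 3 (by decide)) 1 - Finsupp.single (edge 0 3 (by decide)) 1

lemma boundary_edge {u v : Fin 4} (h : u < v) :
    boundary 3 2 (Finsupp.single (edge u v h.ne) 1) =
      Finsupp.single ⟨{v}, rfl⟩ 1 - Finsupp.single ⟨{u}, rfl⟩ 1 := by
  rw [boundary, Finsupp.linearCombination_single, one_smul]
  have hu : u ∈ ({u, v} : Finset (Fin 4)) := by simp
  have hv : v ∈ ({u, v} : Finset (Fin 4)) := by simp
  rw [Finset.sum_eq_add (⟨u, hu⟩ : {w // w ∈ (edge u v h.ne).1}) ⟨v, hv⟩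
    (by simpa [edge] using h.ne)]
  · have h1 : (({u, v} : Finset (Fin 4)).filter (· < u)) = ∅ := by
      simp [Finset.filter_insert, Finset.filter_singleton, h.not_gt]
    have h2 : (({u, v} : Finset (Fin 4)).filter (· < v)) = {u} := by
      simp [Finset.filter_insert, Finset.filter_singleton, h]
    have h3 : ({u, v} : Finset (Fin 4)).erase u = {v} :=
      Finset.erase_insert (by simpa using h.ne)
    have h4 : ({u, v} : Finset (Fin 4)).erase v = {u} := by
      rw [Finset.pair_comm]
      exact Finset.erase_insert (by simpa using h.ne')
    simp only [edge, Face.erase, h1, h2, h3, h4, Finset.card_empty, Finset.card_singleton,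
      pow_zero, pow_one, Finsupp.single_neg]
    rw [sub_eq_add_neg]
  · rintro ⟨w, hw⟩ - ⟨hwu, hwv⟩
    simp only [edge, Finset.mem_insert, Finset.mem_singleton] at hw
    rcases hw with rfl | rfl
    · exact absurd rfl hwu
    · exact absurd rfl hwv
  · simp
  · simp

lemma isCycle_quadrilateral : IsCycle quadrilateral := by
  rw [IsCycle, quadrilateral]
  simp only [map_add, map_sub]
  rw [boundary_edge (by decide), boundary_edge (by decide), boundary_edge (by decide),
    boundary_edge (by decide)]
  abel

/-- The parallelogram `0`, `e`, `e + f`, `f` spanned by the isotropic vectors `e = (1, i)` and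
`f = (1, -i)`. -/
def isotropicQuadrilateral : Fin 4 → Fin 2 → ℂ :=
  ![![0, 0], ![1, Complex.I], ![2, 0], ![1, -Complex.I]]

lemma faceDet_edge (p : Fin 4 → Fin 2 → ℂ) {u v : Fin 4} (h : u < v) :
    faceDet p {u, v} = p u 0 * p v 1 - p v 0 * p u 1 := by
  have hcard : ({u, v} : Finset (Fin 4)).card = 2 := Finset.card_pair h.ne
  have hf : ![u, v] = ({u, v} : Finset (Fin 4)).orderEmbOfFin hcard :=
    Finset.orderEmbOfFin_unique hcard (by simp [Fin.forall_fin_two]) (by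
      rw [Fin.strictMono_iff_lt_succ]; simpa using h)
  rw [faceDet, dif_pos hcard, Matrix.det_fin_two]
  simp [← hf]

lemma chainVolume_toChain_single (p : Fin 4 → Fin 2 → ℂ) {u v : Fin 4} (h : u < v) :
    chainVolume p (toChain 3 2 (Finsupp.single (edge u v h.ne) 1)) =
      p u 0 * p v 1 - p v 0 * p u 1 := by
  rw [← faceDet_edge p h, toChain, Finsupp.linearCombination_single, one_smul, chainVolume,
    Finset.sum_eq_single_of_mem _ (Finset.mem_univ (edge u v h.ne).1)]
  · simp [edge]
  · intro σ _ hσ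
    rw [Pi.single_eq_of_ne hσ]
    simp

lemma eq_edge_of_quadrilateral_ne_zero {σ : Face 3 2} (h : quadrilateral σ ≠ 0) :
    σ.1 = {0, 1} ∨ σ.1 = {1, 2} ∨ σ.1 = {2, 3} ∨ σ.1 = {0, 3} := by
  by_contra! hne
  obtain ⟨h1, h2, h3, h4⟩ := hne
  have key : ∀ {u v : Fin 4} (huv : u ≠ v), σ.1 ≠ {u, v} →
      Finsupp.single (edge u v huv) (1 : ℤ) σ = 0 := fun huv hσ =>
    Finsupp.single_eq_of_ne fun he => hσ (congrArg Subtype.val he)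
  apply h
  rw [quadrilateral, Finsupp.sub_apply, Finsupp.add_apply, Finsupp.add_apply, key _ h1, key _ h2,
    key _ h3, key _ h4]
  rfl

lemma singleton_mem_supp_quadrilateral (v : Fin 4) : {v} ∈ supp quadrilateral := by
  have h1 : quadrilateral (edge 0 1 (by decide)) ≠ 0 := by
    simp only [quadrilateral, Finsupp.sub_apply, Finsupp.add_apply, Finsupp.single_apply]
    decide
  have h2 : quadrilateral (edge 2 3 (by decide)) ≠ 0 := by
    simp only [quadrilateral, Finsupp.sub_apply, Finsupp.add_apply, Finsupp.single_apply]
    decide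
  refine ⟨Finset.singleton_nonempty v, ?_⟩
  fin_cases v
  · exact ⟨_, h1, by decide⟩
  · exact ⟨_, h1, by decide⟩
  · exact ⟨_, h2, by decide⟩
  · exact ⟨_, h2, by decide⟩

/-- All sides of the isotropic parallelogram have length zero, while its area is `-2i`. -/
theorem not_exists_norm_volume_le_quadrilateral :
    ¬ ∃ C : ℝ, ∀ P : Polyhedron quadrilateral,
      ‖P.volume‖ ≤ C * (P.maxSqLength : ℝ) ^ (((2 : ℕ) : ℝ) / 2) := by
  rintro ⟨C, hC⟩
  set P := polyhedronOfVertices quadrilateral isotropicQuadrilateral with hP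
  have hvertex : P.vertex = isotropicQuadrilateral := funext fun v =>
    vertex_polyhedronOfVertices _ _ (singleton_mem_supp_quadrilateral v)
  have h0 : isotropicQuadrilateral 0 = ![0, 0] := rfl
  have h1 : isotropicQuadrilateral 1 = ![1, Complex.I] := rfl
  have h2 : isotropicQuadrilateral 2 = ![2, 0] := rfl
  have h3 : isotropicQuadrilateral 3 = ![1, -Complex.I] := rfl
  have hmax : P.maxSqLength = 0 := by
    classical
    rw [← le_zero_iff]
    unfold Polyhedron.maxSqLength
    refine Finset.sup_le ?_
    rintro ⟨u, v⟩ he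
    obtain ⟨-, -, -, σ, hσ, huv⟩ := Finset.mem_filter.mp he
    suffices h : P.sqLength u v = 0 by simp [h]
    rw [Polyhedron.sqLength, hvertex]
    have hu : u ∈ σ.1 := huv (by simp)
    have hv : v ∈ σ.1 := huv (by simp)
    rcases eq_edge_of_quadrilateral_ne_zero hσ with h | h | h | h <;>
      rw [h, Finset.mem_insert, Finset.mem_singleton] at hu hv <;>
      rcases hu with rfl | rfl <;> rcases hv with rfl | rfl <;>
      norm_num [h0, h1, h2, h3, Fin.sum_univ_two]
  have hvol : P.volume = -2 * Complex.I := by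
    rw [P.volume_eq, hvertex, quadrilateral, map_sub, map_add, map_add, chainVolume_sub,
      chainVolume_add, chainVolume_add, chainVolume_toChain_single _ (by decide),
      chainVolume_toChain_single _ (by decide), chainVolume_toChain_single _ (by decide),
      chainVolume_toChain_single _ (by decide)]
    rw [h0, h1, h2, h3]
    norm_num
    ring
  have h := hC P
  rw [hvol, hmax] at h
  norm_num at h

end Example

end ComplexPolyhedra

theorem corollary8p1 :
    (∀ (n : ℕ), 3 ≤ n → ∀ (M : ℕ) (Z : ComplexPolyhedra.FaceChain M n),
      ComplexPolyhedra.IsCycle Z →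
        ∃ C : ℝ, ∀ P : ComplexPolyhedra.Polyhedron Z,
          ‖P.volume‖ ≤ C * (P.maxSqLength : ℝ) ^ ((n : ℝ) / 2)) ∧
    (∃ (M : ℕ) (Z : ComplexPolyhedra.FaceChain M 2),
      ComplexPolyhedra.IsCycle Z ∧
        ¬ ∃ C : ℝ, ∀ P : ComplexPolyhedra.Polyhedron Z,
          ‖P.volume‖ ≤ C * (P.maxSqLength : ℝ) ^ (((2 : ℕ) : ℝ) / 2)) := by
  exact ⟨fun _ hn _ Z hZ => ComplexPolyhedra.exists_norm_volume_le hn Z hZ,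
    3, ComplexPolyhedra.quadrilateral, ComplexPolyhedra.isCycle_quadrilateral,
    ComplexPolyhedra.not_exists_norm_volume_le_quadrilateral⟩
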